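/- Let $r\ge 2$ be an integer, and write $[r]=\{1,\dots,r\}$. For a finite-dimensional complex Hilbert space $\mathcal H$, let $\mathcal D(\mathcal H)$ be the set of density operators (states) on $\mathcal H$. A channel is a completely positive trace-preserving linear map between the operator spaces of two such Hilbert spaces. A POVM on $\mathcal H$ is a tuple $(M_1,\dots,M_r)$ of positive semi-definite operators with $\sum_i M_i=\mathbb I$. A prior is a tuple $\eta=(\eta_1,\dots,\eta_r)$ of positive reals with $\sum_i\eta_i=1$. We use $-\ln 0=+\infty$ and $0^0=1$. For states $\rho_1,\dots,\rho_r\in\mathcal D(\mathcal H)$ and a prior $\eta$, the optimal antidistinguishability error probability of the $n$-fold ensemble and the optimal error exponent are $$\operatorname{Err}(\mathcal E^n)=\inf_{(M_1,\dots,M_r)\text{ POVM on }\mathcal H^{\otimes n}}\ \sum_{i\in[r]}\eta_i\operatorname{Tr}\!\left[M_i\,\rho_i^{\otimes n}\right],\qquad \operatorname{E}(\rho_1,\dots,\rho_r)=\liminf_{n\to\infty}-\frac1n\ln\operatorname{Err}(\mathcal E^n).$$ For probability measures $P_1,\dots,P_r$ on a measurable space, let $\mu=\sum_i w_iP_i$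 for a prior $w$, let $p_i=dP_i/d\mu$, and define the multivariate classical Chernoff divergence $$\xi_{\mathrm{cl}}(P_1,\dots,P_r)=-\ln\inf_{\mathbf s\in\mathbb S_r}\int p_1^{s_1}\cdots p_r^{s_r}\,d\mu,\qquad \mathbb S_r=\Big\{\mathbf s\in[0,1]^r:\sum_i s_i=1\Big\};$$ this does not depend on the choice of $w$. A multivariate quantum Chernoff divergence is a function $\boldsymbol\xi$ on $r$-tuples of states (of an arbitrary finite-dimensional Hilbert space) with values in $[0,\infty]$ such that 1. (data processing) $\boldsymbol\xi(\rho_1,\dots,\rho_r)\ge\boldsymbol\xi(\mathcal N(\rho_1),\dots,\mathcal N(\rho_r))$ for all states $\rho_1,\dots,\rho_r\in\mathcal D(\mathcal H)$ and every channel $\mathcal N$ from $\mathcal H$ to another finite-dimensional Hilbert space $\mathcal K$; 2. (reduction to the classical divergence) if $\rho_1,\dots,\rho_r$ commute and $\rho_\ell=\sum_{i\in[\dim\mathcal H]}\lambda_{\ell,i}|i\rangle\langle i|$, $\ell\in[r]$, are spectral decompositions in a common orthonormal eigenbasis, then $\boldsymbol\xi(\rho_1,\dots,\rho_r)=\xi_{\mathrm{cl}}(P_1,\dots,P_r)$,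 where $P_\ell(X)=\sum_{i\in X}\lambda_{\ell,i}$ for $X\subseteq[\dim\mathcal H]$. **Proposition.** The optimal error exponent $\operatorname{E}(\rho_1,\dots,\rho_r)$ does not depend on the prior $\eta$, and $\operatorname{E}$ is a multivariate quantum Chernoff divergence. -/

import Mathlib

open scoped ENNReal ComplexOrder Matrix

universe u

/-! ### Classical part: Hellinger transform and multivariate Chernoff divergence -/

/-- A prior probability distribution on `[r]` with strictly positive weights. -/
def IsPrior {r : ℕ} (η : Fin r → ℝ) : Prop :=
  (∀ i, 0 < η i) ∧ ∑ i, η i = 1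

/-- The dominating measure `μ = ∑ i, η i • P i` of an ensemble of measures. -/
noncomputable def dominatingMeasure {r : ℕ} {Ω : Type*} [MeasurableSpace Ω]
    (η : Fin r → ℝ) (P : Fin r → MeasureTheory.Measure Ω) : MeasureTheory.Measure Ω :=
  ∑ i, ENNReal.ofReal (η i) • P i

/-- The Hellinger transform `∫ p₁ ^ s₁ ⋯ p_r ^ s_r dμ`, where `p i = dP i / dμ`
(with the convention `0 ^ 0 = 1`, which is the one of `ENNReal.rpow`). -/
noncomputable def hellingerTransform {r : ℕ} {Ω : Type*} [MeasurableSpace Ω]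
    (η : Fin r → ℝ) (P : Fin r → MeasureTheory.Measure Ω) (s : Fin r → ℝ) : ℝ≥0∞ :=
  ∫⁻ ω, ∏ i, ((P i).rnDeriv (dominatingMeasure η P) ω) ^ (s i) ∂(dominatingMeasure η P)

/-- The multivariate classical Chernoff divergence `- ln inf_{s ∈ 𝕊_r} ℍ_s(P₁, …, P_r)`, an
extended real number (`- ln 0 = +∞`), computed with the dominating measure `∑ i, η i • P i`. -/
noncomputable def classicalChernoffDivergence {r : ℕ} {Ω : Type*} [MeasurableSpace Ω]
    (η : Fin r → ℝ) (P : Fin r → MeasureTheory.Measure Ω) : EReal :=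
  -ENNReal.log (⨅ s ∈ stdSimplex ℝ (Fin r), hellingerTransform η P s)

/-- The measure `P(X) = ∑_{i ∈ X} w i` on a finite set of the form `[m]`. -/
noncomputable def weightMeasure {m : ℕ} (w : Fin m → ℝ) : MeasureTheory.Measure (Fin m) :=
  ∑ i, ENNReal.ofReal (w i) • MeasureTheory.Measure.dirac i

/-! ### States and channels on the Hilbert spaces `ℂ^d`, with `d` a finite index set -/

/-- Density operators (quantum states) on `ℂ^d`. -/
structure DensityMatrix (d : Type u) [Fintype d] where
  /-- the underlying operator -/
  mat : Matrix d d ℂ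
  posSemidef : mat.PosSemidef
  trace_eq_one : mat.trace = 1

/-- The map `id_k ⊗ N` on `M_k(ℂ) ⊗ M_d(ℂ)`, i.e. `N` applied to each `d × d` block. -/
def ampliation {d e : Type u} (k : ℕ) (N : Matrix d d ℂ →ₗ[ℂ] Matrix e e ℂ)
    (A : Matrix (Fin k × d) (Fin k × d) ℂ) : Matrix (Fin k × e) (Fin k × e) ℂ :=
  Matrix.of fun x y => N (Matrix.of fun i j => A (x.1, i) (y.1, j)) x.2 y.2

/-- Quantum channels: completely positive, trace-preserving linear maps. -/
structure QuantumChannel (d e : Type u) [Fintype d] [Fintype e] where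
  /-- the underlying linear map -/
  map : Matrix d d ℂ →ₗ[ℂ] Matrix e e ℂ
  completelyPositive : ∀ (k : ℕ) (A : Matrix (Fin k × d) (Fin k × d) ℂ),
    A.PosSemidef → (ampliation k map A).PosSemidef
  tracePreserving : ∀ X : Matrix d d ℂ, (map X).trace = X.trace

/-- A channel maps states to states. -/
def QuantumChannel.apply {d e : Type u} [Fintype d] [Fintype e]
    (N : QuantumChannel d e) (ρ : DensityMatrix d) : DensityMatrix e where
  mat := N.map ρ.mat
  posSemidef := by
    have h := N.completelyPositive 1 (ρ.mat.submatrix Prod.snd Prod.snd)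
      (ρ.posSemidef.submatrix _)
    exact h.submatrix (fun i => ((0 : Fin 1), i))
  trace_eq_one := by rw [N.tracePreserving, ρ.trace_eq_one]

/-- The `n`-fold tensor power `X^{⊗ n}`, acting on `(ℂ^d)^{⊗ n} = ℂ^(d^n)`. -/
def tensorPowerMatrix {d : Type u} (n : ℕ) (X : Matrix d d ℂ) :
    Matrix (Fin n → d) (Fin n → d) ℂ :=
  Matrix.of fun x y => ∏ k, X (x k) (y k)

theorem tensorPowerMatrix_mul {d : Type u} [Fintype d] (n : ℕ) (X Y : Matrix d d ℂ) :
    tensorPowerMatrix n (X * Y) = tensorPowerMatrix n X * tensorPowerMatrix n Y := by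
  classical
  ext x y
  simp only [tensorPowerMatrix, Matrix.of_apply, Matrix.mul_apply]
  rw [Fintype.prod_sum]
  simp only [Finset.prod_mul_distrib]

theorem tensorPowerMatrix_conjTranspose {d : Type u} (n : ℕ) (X : Matrix d d ℂ) :
    tensorPowerMatrix n Xᴴ = (tensorPowerMatrix n X)ᴴ := by
  ext x y
  simp [tensorPowerMatrix, Matrix.conjTranspose_apply]

open scoped MatrixOrder Matrix.Norms.L2Operator in
theorem tensorPowerMatrix_posSemidef {d : Type u} [Fintype d] (n : ℕ) {X : Matrix d d ℂ}
    (hX : X.PosSemidef) : (tensorPowerMatrix n X).PosSemidef := by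
  classical
  obtain ⟨B, rfl⟩ := CStarAlgebra.nonneg_iff_eq_star_mul_self.mp hX.nonneg
  rw [Matrix.star_eq_conjTranspose, tensorPowerMatrix_mul, tensorPowerMatrix_conjTranspose]
  exact Matrix.posSemidef_conjTranspose_mul_self _

/-- The state `ρ^{⊗ n}`. -/
def DensityMatrix.tensorPower {d : Type u} [Fintype d]
    (n : ℕ) (ρ : DensityMatrix d) : DensityMatrix (Fin n → d) where
  mat := tensorPowerMatrix n ρ.mat
  posSemidef := tensorPowerMatrix_posSemidef n ρ.posSemidef
  trace_eq_one := by
    classical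
    have h := ρ.trace_eq_one
    simp only [Matrix.trace, Matrix.diag_apply, tensorPowerMatrix, Matrix.of_apply] at h ⊢
    rw [← Fintype.prod_sum (fun (_ : Fin n) i => ρ.mat i i)]
    simp [h]

/-! ### Quantum antidistinguishability -/

/-- POVMs `{M₁, …, M_r}` on `ℂ^d`. -/
structure POVM (r : ℕ) (d : Type u) [Fintype d] [DecidableEq d] where
  /-- the measurement operators -/
  op : Fin r → Matrix d d ℂ
  posSemidef : ∀ i, (op i).PosSemidef
  sum_eq_one : ∑ i, op i = 1

/-- The average error probability `∑ i, η i Tr[M i ρ i]` of a POVM (each trace is real). -/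
noncomputable def errorProbability {r : ℕ} {d : Type u} [Fintype d] [DecidableEq d]
    (M : POVM r d) (η : Fin r → ℝ) (ρ : Fin r → DensityMatrix d) : ℝ :=
  ∑ i, η i * ((M.op i * (ρ i).mat).trace).re

/-- The optimal antidistinguishability error probability of an ensemble. -/
noncomputable def optimalErrorProbability {r : ℕ} {d : Type u} [Fintype d] [DecidableEq d]
    (η : Fin r → ℝ) (ρ : Fin r → DensityMatrix d) : ℝ :=
  ⨅ M : POVM r d, errorProbability M η ρ

/-- The optimal error exponent `liminf_n - (1/n) ln Err(ℰⁿ)`, where `ℰⁿ` is the ensemble of the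
states `ρ i ^{⊗ n}` with the same priors; it is an extended real number (`- ln 0 = +∞`). -/
noncomputable def optimalErrorExponent {r : ℕ} (η : Fin r → ℝ)
    (d : Type u) [Fintype d] [DecidableEq d] (ρ : Fin r → DensityMatrix d) : EReal :=
  Filter.liminf
    (fun n : ℕ => -ENNReal.log (ENNReal.ofReal
      (optimalErrorProbability η fun i => (ρ i).tensorPower n)) / (n : EReal))
    Filter.atTop

/-! ### Multivariate quantum Chernoff divergences -/

/-- `ρ ℓ = ∑ i, lam ℓ i |b i⟩⟨b i|` for all `ℓ`: spectral decompositions of the states in a common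
orthonormal eigenbasis `b`, which is indexed by `[dim ℂ^d]`. -/
def IsCommonSpectralDecomposition {r : ℕ} {d : Type u} [Fintype d]
    (ρ : Fin r → DensityMatrix d)
    (b : OrthonormalBasis (Fin (Fintype.card d)) ℂ (EuclideanSpace ℂ d))
    (lam : Fin r → Fin (Fintype.card d) → ℝ) : Prop :=
  ∀ l, (ρ l).mat = ∑ i, (lam l i : ℂ) • Matrix.vecMulVec (b i).ofLp (star (b i).ofLp)

/-- A function `ξ` on `r`-tuples of states (of an arbitrary finite-dimensional system) is a
multivariate quantum Chernoff divergence if it takes values in `[0, ∞]`, satisfies data processing,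
and on commuting states equals the multivariate classical Chernoff divergence of the probability
measures given by the eigenvalues in a common eigenbasis. That divergence does not depend on the
weights `w` of the dominating measure; the equality is demanded for all of them. -/
structure IsMultivariateQuantumChernoffDivergence {r : ℕ}
    (ξ : ∀ (d : Type u) [Fintype d] [DecidableEq d], (Fin r → DensityMatrix d) → EReal) :
    Prop where
  nonneg : ∀ (d : Type u) [Fintype d] [DecidableEq d] (ρ : Fin r → DensityMatrix d), 0 ≤ ξ d ρ
  data_processing : ∀ (d e : Type u) [Fintype d] [DecidableEq d] [Fintype e] [DecidableEq e]
    (ρ : Fin r → DensityMatrix d) (N : QuantumChannel d e),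
    ξ e (fun i => N.apply (ρ i)) ≤ ξ d ρ
  eq_classical_of_commute : ∀ (d : Type u) [Fintype d] [DecidableEq d]
    (ρ : Fin r → DensityMatrix d), (∀ i j, Commute (ρ i).mat (ρ j).mat) →
    ∀ (b : OrthonormalBasis (Fin (Fintype.card d)) ℂ (EuclideanSpace ℂ d))
      (lam : Fin r → Fin (Fintype.card d) → ℝ), IsCommonSpectralDecomposition ρ b lam →
    ∀ w : Fin r → ℝ, IsPrior w →
      ξ d ρ = classicalChernoffDivergence w (fun l => weightMeasure (lam l))

/-!
Write `Err n` for the optimal error of the `n`-fold ensemble.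

*Prior.* Two priors differ by a bounded factor, which changes `Err n` by a bounded factor and so
does not affect its exponential rate (`decayRate_le_of_mul_le`).

*Data processing.* A channel has a Kraus decomposition `N(X) = ∑ z, K z * X * (K z)ᴴ`
(`QuantumChannel.exists_kraus`). The words in the `K z` are Kraus operators of the `n`-fold tensor
power of `N`, and its adjoint turns a POVM on the output into a POVM on the input with the same
error (`optimalErrorProbability_tensorPower_le_apply`).

*Commuting states.* In a common eigenbasis, a measurement is a randomised classical decision rule,
so `Err n` is squeezed by sums over words `x` of `n` letters. With
`Z s = ∑ x, ∏ i, (lam i x) ^ (s i)`: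

* Upper bound on `Err n`. Announce a hypothesis of least likelihood. As a minimum is at most any
  weighted geometric mean, `Err n ≤ (Z s) ^ n` for every `s` in the simplex
  (`optimalErrorProbability_tensorPower_le_pow`).
* Lower bound on `Err n`. Restrict `Z` to the common support of the weights, where it is smooth,
  and let `s` be its minimiser. The first order conditions at `s` say that under the tilted
  distribution `q ∝ ∏ i, (lam i) ^ (s i)` every log-likelihood has at least the expectation of
  their `s`-mixture. Hence every product weight of a word is at least `(Z s) ^ n` times its
  `q`-probability, up to the exponential of centred sums under `q`
  (`exists_common_lower_bound`). These are of order `√n` on average, and Jensen's inequality gives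
  `Err n ≥ c * exp (-C * √n) * (Z s) ^ n` (`exists_exp_neg_sqrt_le`).

At the boundary of the simplex `0 ^ 0 = 1` makes the Hellinger transform larger than the sum over
the common support, but the two agree in the interior, so their infima coincide
(`iInf_hellinger_le`). If there is no common support, both sides are `+∞`.
-/

/-! ### Tensor powers of rectangular matrices -/

/-- The `n`-fold tensor power of a rectangular matrix; on square matrices it is
`tensorPowerMatrix`. -/
def rectTensorPower {a b : Type*} (n : ℕ) (X : Matrix a b ℂ) :
    Matrix (Fin n → a) (Fin n → b) ℂ :=
  Matrix.of fun x y => ∏ k, X (x k) (y k)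

theorem rectTensorPower_mul {a b c : Type*} [Fintype b] (n : ℕ) (X : Matrix a b ℂ)
    (Y : Matrix b c ℂ) :
    rectTensorPower n (X * Y) = rectTensorPower n X * rectTensorPower n Y := by
  classical
  ext x y
  simp only [rectTensorPower, Matrix.of_apply, Matrix.mul_apply]
  rw [Fintype.prod_sum]
  simp only [Finset.prod_mul_distrib]

theorem rectTensorPower_conjTranspose {a b : Type*} (n : ℕ) (X : Matrix a b ℂ) :
    rectTensorPower n Xᴴ = (rectTensorPower n X)ᴴ := by
  ext x y
  simp [rectTensorPower, Matrix.conjTranspose_apply]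

theorem rectTensorPower_diagonal {a : Type*} [DecidableEq a] (n : ℕ) (p : a → ℂ) :
    rectTensorPower n (Matrix.diagonal p) = Matrix.diagonal fun x => ∏ k, p (x k) := by
  ext x y
  simp only [rectTensorPower, Matrix.of_apply, Matrix.diagonal_apply]
  split_ifs with h
  · subst h; simp
  · obtain ⟨k, hk⟩ := Function.ne_iff.mp h
    exact Finset.prod_eq_zero (Finset.mem_univ k) (by simp [hk])

theorem rectTensorPower_one {a : Type*} [DecidableEq a] (n : ℕ) :
    rectTensorPower n (1 : Matrix a a ℂ) = 1 := by
  rw [← Matrix.diagonal_one, rectTensorPower_diagonal]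
  simp

/-- The tensor product of the family of matrices `X (z 0), …, X (z (n - 1))`. -/
def tensorWord {a b ι : Type*} {n : ℕ} (X : ι → Matrix a b ℂ) (z : Fin n → ι) :
    Matrix (Fin n → a) (Fin n → b) ℂ :=
  Matrix.of fun x y => ∏ k, X (z k) (x k) (y k)

/-- The tensor power of a sum expands over all choices of one summand per tensor factor. -/
theorem rectTensorPower_sum {a b ι : Type*} [Fintype ι] (n : ℕ) (X : ι → Matrix a b ℂ) :
    rectTensorPower n (∑ z, X z) =
      ∑ z : Fin n → ι, tensorWord X z := by
  classical
  ext x y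
  simp only [rectTensorPower, tensorWord, Matrix.of_apply, Matrix.sum_apply]
  rw [Fintype.prod_sum]

theorem tensorWord_mul {a b c ι : Type*} [Fintype b] {n : ℕ} (X : ι → Matrix a b ℂ)
    (Y : ι → Matrix b c ℂ) (z : Fin n → ι) :
    tensorWord (fun i => X i * Y i) z = tensorWord X z * tensorWord Y z := by
  classical
  ext x y
  simp only [tensorWord, Matrix.of_apply, Matrix.mul_apply]
  rw [Fintype.prod_sum]
  simp only [Finset.prod_mul_distrib]

theorem tensorWord_conjTranspose {a b ι : Type*} {n : ℕ} (X : ι → Matrix a b ℂ)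
    (z : Fin n → ι) : tensorWord (fun i => (X i)ᴴ) z = (tensorWord X z)ᴴ := by
  ext x y
  simp [tensorWord, Matrix.conjTranspose_apply]

/-! ### Kraus operators and data processing for the optimal error probability -/

open scoped MatrixOrder Matrix.Norms.L2Operator in
theorem Matrix.PosSemidef.exists_eq_conjTranspose_mul_self {d : Type*} [Fintype d]
    {X : Matrix d d ℂ} (hX : X.PosSemidef) : ∃ B : Matrix d d ℂ, X = Bᴴ * B := by
  classical
  obtain ⟨B, hB⟩ := CStarAlgebra.nonneg_iff_eq_star_mul_self.mp hX.nonneg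
  exact ⟨B, hB⟩

/-- Kraus decomposition of a channel, obtained by factoring its positive semidefinite Choi
matrix. -/
theorem QuantumChannel.exists_kraus {d e : Type u} [Fintype d] [Fintype e] [DecidableEq d]
    (N : QuantumChannel d e) :
    ∃ K : Fin (Fintype.card d) × e → Matrix e d ℂ,
      (∀ X, N.map X = ∑ z, K z * X * (K z)ᴴ) ∧ ∑ z, (K z)ᴴ * K z = 1 := by
  let ε := (Fintype.equivFin d).symm
  let v : Fin (Fintype.card d) × d → ℂ := fun x => if ε x.1 = x.2 then 1 else 0
  obtain ⟨B, hB⟩ := (N.completelyPositive _ _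
    (Matrix.posSemidef_vecMulVec_self_star v)).exists_eq_conjTranspose_mul_self
  have hE : ∀ a b i j, N.map (Matrix.single a b 1) i j =
      ∑ z, star (B z (ε.symm a, i)) * B z (ε.symm b, j) := by
    intro a b i j
    have h := congrFun (congrFun hB (ε.symm a, i)) (ε.symm b, j)
    simp only [ampliation, Matrix.of_apply, Matrix.mul_apply, Matrix.conjTranspose_apply] at h
    have hs : Matrix.single a b (1 : ℂ) = Matrix.of fun k l =>
        Matrix.vecMulVec v (star v) (ε.symm a, k) (ε.symm b, l) := by
      ext k l
      simp only [Matrix.single_apply, Matrix.of_apply, Matrix.vecMulVec_apply, v, Pi.star_apply,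
        Equiv.apply_symm_apply]
      by_cases h1 : a = k <;> by_cases h2 : b = l <;> simp [h1, h2]
    rw [← h, hs]
  let K : Fin (Fintype.card d) × e → Matrix e d ℂ :=
    fun z => Matrix.of fun i a => star (B z (ε.symm a, i))
  have hK : ∀ X, N.map X = ∑ z, K z * X * (K z)ᴴ := by
    intro X
    ext i j
    conv_lhs => rw [Matrix.matrix_eq_sum_single X]
    have hs : ∀ a b, Matrix.single a b (X a b) = X a b • Matrix.single a b (1 : ℂ) := by
      intro a b; simp [Matrix.smul_single]
    simp only [hs, map_sum, map_smul, Matrix.sum_apply, Matrix.smul_apply, hE, smul_eq_mul,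
      Matrix.mul_apply, Matrix.conjTranspose_apply, K, Matrix.of_apply, star_star]
    simp only [Finset.mul_sum, Finset.sum_mul]
    rw [Finset.sum_comm' (t' := Finset.univ) (s' := fun _ => Finset.univ) (by simp)]
    conv_lhs => enter [2, b]; rw [Finset.sum_comm]
    rw [Finset.sum_comm]
    refine Finset.sum_congr rfl fun z _ => Finset.sum_congr rfl fun b _ =>
      Finset.sum_congr rfl fun a _ => by ring
  refine ⟨K, hK, ?_⟩
  rw [Matrix.ext_iff_trace_mul_right]
  intro X
  rw [Matrix.one_mul, ← N.tracePreserving X, hK, Matrix.sum_mul, Matrix.trace_sum,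
    Matrix.trace_sum]
  refine Finset.sum_congr rfl fun z _ => ?_
  rw [Matrix.mul_assoc, Matrix.trace_mul_comm, Matrix.mul_assoc]

theorem errorProbability_nonneg {r : ℕ} {d : Type u} [Fintype d] [DecidableEq d]
    {η : Fin r → ℝ} (hη : ∀ i, 0 ≤ η i) (M : POVM r d) (ρ : Fin r → DensityMatrix d) :
    0 ≤ errorProbability M η ρ := by
  refine Finset.sum_nonneg fun i _ => mul_nonneg (hη i) ?_
  obtain ⟨B, hB⟩ := (ρ i).posSemidef.exists_eq_conjTranspose_mul_self
  have h : 0 ≤ (B * M.op i * Bᴴ).trace :=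
    ((M.posSemidef i).mul_mul_conjTranspose_same B).trace_nonneg
  rw [hB, ← Matrix.mul_assoc, Matrix.trace_mul_comm, ← Matrix.mul_assoc]
  exact (Complex.le_def.mp h).1

theorem optimalErrorProbability_le {r : ℕ} {d : Type u} [Fintype d] [DecidableEq d]
    {η : Fin r → ℝ} (hη : ∀ i, 0 ≤ η i) (M : POVM r d) (ρ : Fin r → DensityMatrix d) :
    optimalErrorProbability η ρ ≤ errorProbability M η ρ :=
  ciInf_le ⟨0, by rintro _ ⟨M, rfl⟩; exact errorProbability_nonneg hη M ρ⟩ M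

/-- The measurement with the deterministic outcome `j`. -/
def POVM.const {r : ℕ} (d : Type u) [Fintype d] [DecidableEq d] (j : Fin r) : POVM r d where
  op i := if i = j then 1 else 0
  posSemidef i := by
    split_ifs
    · exact Matrix.PosSemidef.one
    · exact Matrix.PosSemidef.zero
  sum_eq_one := by simp

theorem le_optimalErrorProbability {r : ℕ} (hr : 0 < r) {d : Type u} [Fintype d]
    [DecidableEq d] {η : Fin r → ℝ} {ρ : Fin r → DensityMatrix d} {c : ℝ}
    (h : ∀ M : POVM r d, c ≤ errorProbability M η ρ) : c ≤ optimalErrorProbability η ρ :=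
  have : Nonempty (POVM r d) := ⟨POVM.const d ⟨0, hr⟩⟩
  le_ciInf h

theorem IsPrior.le_one {r : ℕ} {η : Fin r → ℝ} (hη : IsPrior η) (i : Fin r) : η i ≤ 1 :=
  hη.2 ▸ Finset.single_le_sum (fun j _ => (hη.1 j).le) (Finset.mem_univ i)

theorem optimalErrorProbability_le_one {r : ℕ} (hr : 0 < r) {d : Type u} [Fintype d]
    [DecidableEq d] {η : Fin r → ℝ} (hη : IsPrior η) (ρ : Fin r → DensityMatrix d) :
    optimalErrorProbability η ρ ≤ 1 := by
  refine (optimalErrorProbability_le (fun i => (hη.1 i).le) (POVM.const d ⟨0, hr⟩) ρ).trans ?_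
  rw [errorProbability, Finset.sum_eq_single ⟨0, hr⟩]
  · simpa [POVM.const, (ρ _).trace_eq_one] using hη.le_one _
  · intro i _ hi
    simp [POVM.const, hi]
  · simp

/-- Measuring after the `n`-fold tensor power of a channel is itself a measurement (apply the
adjoint of the channel to the POVM), so a channel cannot decrease the optimal error. -/
theorem optimalErrorProbability_tensorPower_le_apply {r : ℕ} (hr : 0 < r) {d e : Type u}
    [Fintype d] [DecidableEq d] [Fintype e] [DecidableEq e] {η : Fin r → ℝ}
    (hη : ∀ i, 0 ≤ η i) (ρ : Fin r → DensityMatrix d) (N : QuantumChannel d e) (n : ℕ) :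
    optimalErrorProbability η (fun i => (ρ i).tensorPower n) ≤
      optimalErrorProbability η (fun i => (N.apply (ρ i)).tensorPower n) := by
  obtain ⟨K, hK, hK1⟩ := N.exists_kraus
  have hK1n : ∑ z : Fin n → Fin (Fintype.card d) × e, (tensorWord K z)ᴴ * tensorWord K z = 1 := by
    have h := rectTensorPower_sum n (fun z => (K z)ᴴ * K z)
    rw [hK1, rectTensorPower_one] at h
    rw [h]
    refine Finset.sum_congr rfl fun z _ => ?_
    rw [← tensorWord_conjTranspose, ← tensorWord_mul]
  have hKn : ∀ X, rectTensorPower n (N.map X) =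
      ∑ z : Fin n → Fin (Fintype.card d) × e,
        tensorWord K z * rectTensorPower n X * (tensorWord K z)ᴴ := by
    intro X
    rw [hK, rectTensorPower_sum]
    refine Finset.sum_congr rfl fun z _ => ?_
    rw [← tensorWord_conjTranspose]
    have h1 : rectTensorPower n X = tensorWord (fun _ => X) z := rfl
    rw [h1, ← tensorWord_mul, ← tensorWord_mul]
  refine le_optimalErrorProbability hr fun M => ?_
  let M' : POVM r (Fin n → d) :=
    { op := fun i => ∑ z : Fin n → Fin (Fintype.card d) × e,
        (tensorWord K z)ᴴ * M.op i * tensorWord K z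
      posSemidef := fun i => Matrix.posSemidef_sum _ fun z _ =>
        (M.posSemidef i).conjTranspose_mul_mul_same _
      sum_eq_one := by
        rw [Finset.sum_comm, ← hK1n]
        refine Finset.sum_congr rfl fun z _ => ?_
        rw [← Matrix.sum_mul, ← Matrix.mul_sum, M.sum_eq_one, Matrix.mul_one] }
  refine (optimalErrorProbability_le hη M' _).trans_eq ?_
  unfold errorProbability
  refine Finset.sum_congr rfl fun i _ => ?_
  congr 2
  change ((∑ z : Fin n → Fin (Fintype.card d) × e,
        (tensorWord K z)ᴴ * M.op i * tensorWord K z) * rectTensorPower n (ρ i).mat).trace =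
    (M.op i * rectTensorPower n (N.map (ρ i).mat)).trace
  rw [hKn, Matrix.sum_mul, Matrix.mul_sum, Matrix.trace_sum, Matrix.trace_sum]
  refine Finset.sum_congr rfl fun z _ => ?_
  rw [Matrix.mul_assoc, Matrix.mul_assoc, Matrix.trace_mul_comm, Matrix.mul_assoc]

/-! ### The optimal error of commuting ensembles -/

theorem trace_mul_conj_diagonal {D m : Type*} [Fintype D] [Fintype m] [DecidableEq m]
    (A : Matrix D D ℂ) (V : Matrix D m ℂ) (p : m → ℝ) :
    (A * (V * Matrix.diagonal (fun x => (p x : ℂ)) * Vᴴ)).trace.re =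
      ∑ x, ((Vᴴ * A * V) x x).re * p x := by
  rw [← Matrix.mul_assoc, Matrix.trace_mul_comm, ← Matrix.mul_assoc, ← Matrix.mul_assoc,
    Matrix.trace]
  simp [Matrix.mul_diagonal]

/-- Lower bound on the error for states that are diagonal in a common orthonormal basis (the
columns of `V`): every measurement acts as a randomised classical decision rule. -/
theorem sum_le_errorProbability_of_diagonal {r : ℕ} {D : Type u} {m : Type*} [Fintype D]
    [DecidableEq D] [Fintype m] [DecidableEq m] {V : Matrix D m ℂ} (hV : Vᴴ * V = 1)
    {η : Fin r → ℝ} {ρ : Fin r → DensityMatrix D} {p : Fin r → m → ℝ}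
    (hρ : ∀ i, (ρ i).mat = V * Matrix.diagonal (fun x => (p i x : ℂ)) * Vᴴ)
    {q : m → ℝ} (hq : ∀ i x, q x ≤ η i * p i x) (M : POVM r D) :
    ∑ x, q x ≤ errorProbability M η ρ := by
  have hsum : ∀ x, ∑ i, ((Vᴴ * M.op i * V) x x).re = 1 := by
    intro x
    rw [← Complex.re_sum, ← Matrix.sum_apply, ← Matrix.sum_mul, ← Matrix.mul_sum,
      M.sum_eq_one, Matrix.mul_one, hV]
    simp
  calc ∑ x, q x = ∑ x, ∑ i, ((Vᴴ * M.op i * V) x x).re * q x := by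
        refine Finset.sum_congr rfl fun x _ => ?_
        rw [← Finset.sum_mul, hsum, one_mul]
    _ ≤ ∑ x, ∑ i, ((Vᴴ * M.op i * V) x x).re * (η i * p i x) := by
        gcongr with x _ i _
        · exact (Complex.le_def.mp
            (((M.posSemidef i).conjTranspose_mul_mul_same V).diag_nonneg (i := x))).1
        · exact hq i x
    _ = errorProbability M η ρ := by
        rw [Finset.sum_comm, errorProbability]
        refine Finset.sum_congr rfl fun i _ => ?_
        rw [hρ, trace_mul_conj_diagonal, Finset.mul_sum]
        exact Finset.sum_congr rfl fun x _ => by ring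

/-- For states diagonal in a common orthonormal basis, every deterministic classical decision
rule `f` is realised by a projective measurement. -/
theorem optimalErrorProbability_le_sum_of_diagonal {r : ℕ} {D : Type u} {m : Type*} [Fintype D]
    [DecidableEq D] [Fintype m] [DecidableEq m] {V : Matrix D m ℂ} (hV : Vᴴ * V = 1)
    (hV' : V * Vᴴ = 1) {η : Fin r → ℝ} (hη : ∀ i, 0 ≤ η i) {ρ : Fin r → DensityMatrix D}
    {p : Fin r → m → ℝ}
    (hρ : ∀ i, (ρ i).mat = V * Matrix.diagonal (fun x => (p i x : ℂ)) * Vᴴ) (f : m → Fin r) :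
    optimalErrorProbability η ρ ≤ ∑ x, η (f x) * p (f x) x := by
  let M : POVM r D :=
    { op := fun i => V * Matrix.diagonal (fun x => if f x = i then (1 : ℂ) else 0) * Vᴴ
      posSemidef := fun i => (Matrix.PosSemidef.diagonal fun x => by
        dsimp only [Pi.zero_apply]; split_ifs <;> simp).mul_mul_conjTranspose_same V
      sum_eq_one := by
        rw [← Matrix.sum_mul, ← Matrix.mul_sum]
        have h : ∑ i, Matrix.diagonal (fun x => if f x = i then (1 : ℂ) else 0) = 1 := by
          ext x y
          by_cases hxy : x = y
          · subst hxy; simp [Matrix.sum_apply]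
          · simp [Matrix.sum_apply, hxy]
        rw [h, Matrix.mul_one, hV'] }
  refine (optimalErrorProbability_le hη M ρ).trans_eq ?_
  have hM : ∀ i, Vᴴ * M.op i * V =
      Matrix.diagonal (fun x => if f x = i then (1 : ℂ) else 0) := by
    intro i
    change Vᴴ * (V * _ * Vᴴ) * V = _
    rw [Matrix.mul_assoc V, ← Matrix.mul_assoc Vᴴ, hV, Matrix.one_mul, Matrix.mul_assoc, hV,
      Matrix.mul_one]
  simp only [errorProbability, hρ, trace_mul_conj_diagonal, hM, Matrix.diagonal_apply_eq,
    Finset.mul_sum]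
  rw [Finset.sum_comm]
  refine Finset.sum_congr rfl fun x _ => ?_
  rw [Finset.sum_eq_single (f x)]
  · simp
  · intro i _ hi
    simp [hi.symm]
  · simp

/-- The matrix whose columns are the vectors of an orthonormal basis. -/
noncomputable def basisMatrix {d m : Type*} [Fintype d] [Fintype m]
    (b : OrthonormalBasis m ℂ (EuclideanSpace ℂ d)) : Matrix d m ℂ :=
  Matrix.of fun i j => b j i

theorem basisMatrix_conjTranspose_mul {d m : Type*} [Fintype d] [Fintype m] [DecidableEq m]
    (b : OrthonormalBasis m ℂ (EuclideanSpace ℂ d)) : (basisMatrix b)ᴴ * basisMatrix b = 1 := by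
  ext i j
  have h := orthonormal_iff_ite.mp b.orthonormal i j
  rw [PiLp.inner_apply] at h
  rw [Matrix.one_apply, ← h]
  simp [basisMatrix, Matrix.mul_apply, mul_comm]

theorem basisMatrix_mul_conjTranspose {d m : Type*} [Fintype d] [Fintype m] [DecidableEq d]
    (b : OrthonormalBasis m ℂ (EuclideanSpace ℂ d)) : basisMatrix b * (basisMatrix b)ᴴ = 1 := by
  classical
  have hc : Fintype.card d = Fintype.card m := by
    rw [← finrank_euclideanSpace (𝕜 := ℂ) (ι := d), Module.finrank_eq_card_basis b.toBasis]
  exact (Matrix.mul_eq_one_comm_of_card_eq m d ℂ hc.symm).mp (basisMatrix_conjTranspose_mul b)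

theorem IsCommonSpectralDecomposition.mat_eq {r : ℕ} {d : Type u} [Fintype d]
    {ρ : Fin r → DensityMatrix d}
    {b : OrthonormalBasis (Fin (Fintype.card d)) ℂ (EuclideanSpace ℂ d)}
    {lam : Fin r → Fin (Fintype.card d) → ℝ} (h : IsCommonSpectralDecomposition ρ b lam)
    (i : Fin r) :
    (ρ i).mat = basisMatrix b * Matrix.diagonal (fun x => (lam i x : ℂ)) * (basisMatrix b)ᴴ := by
  rw [h i]
  ext x y
  simp only [Matrix.sum_apply, Matrix.smul_apply, Matrix.vecMulVec_apply, Matrix.mul_apply,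
    basisMatrix, Matrix.conjTranspose_apply, Matrix.of_apply, Matrix.diagonal_apply,
    Pi.star_apply, smul_eq_mul, mul_ite, mul_zero, Finset.sum_ite_eq', Finset.mem_univ, if_true]
  exact Finset.sum_congr rfl fun z _ => by ring

theorem IsCommonSpectralDecomposition.nonneg {r : ℕ} {d : Type u} [Fintype d]
    {ρ : Fin r → DensityMatrix d}
    {b : OrthonormalBasis (Fin (Fintype.card d)) ℂ (EuclideanSpace ℂ d)}
    {lam : Fin r → Fin (Fintype.card d) → ℝ} (h : IsCommonSpectralDecomposition ρ b lam)
    (i : Fin r) (x : Fin (Fintype.card d)) : 0 ≤ lam i x := by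
  have h1 := ((ρ i).posSemidef.conjTranspose_mul_mul_same (basisMatrix b)).diag_nonneg (i := x)
  rw [h.mat_eq i, Matrix.mul_assoc (basisMatrix b), ← Matrix.mul_assoc (basisMatrix b)ᴴ,
    basisMatrix_conjTranspose_mul, Matrix.one_mul, Matrix.mul_assoc,
    basisMatrix_conjTranspose_mul, Matrix.mul_one, Matrix.diagonal_apply_eq] at h1
  exact_mod_cast h1

theorem IsCommonSpectralDecomposition.tensorPower_mat_eq {r : ℕ} {d : Type u} [Fintype d]
    {ρ : Fin r → DensityMatrix d}
    {b : OrthonormalBasis (Fin (Fintype.card d)) ℂ (EuclideanSpace ℂ d)}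
    {lam : Fin r → Fin (Fintype.card d) → ℝ} (h : IsCommonSpectralDecomposition ρ b lam)
    (n : ℕ) (i : Fin r) :
    ((ρ i).tensorPower n).mat = rectTensorPower n (basisMatrix b) *
      (Matrix.diagonal (fun x => ((∏ k, lam i (x k) : ℝ) : ℂ)) :
        Matrix (Fin n → Fin (Fintype.card d)) (Fin n → Fin (Fintype.card d)) ℂ) *
        (rectTensorPower n (basisMatrix b))ᴴ := by
  change rectTensorPower n (ρ i).mat = _
  rw [h.mat_eq i, rectTensorPower_mul, rectTensorPower_mul, rectTensorPower_conjTranspose,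
    rectTensorPower_diagonal]
  simp only [Complex.ofReal_prod]

/-! ### Sums of independent centred variables over a finite alphabet -/

theorem sum_fin_succ_pi {m : Type*} [Fintype m] (n : ℕ) (F : (Fin (n + 1) → m) → ℝ) :
    ∑ x, F x = ∑ a, ∑ x : Fin n → m, F (Fin.cons a x) := by
  rw [← (Fin.consEquiv fun _ => m).sum_comp, Fintype.sum_prod_type]
  rfl

theorem sum_prod_mul_sum_eq_zero {m : Type*} [Fintype m] {q b : m → ℝ} (hq : ∑ x, q x = 1)
    (hb : ∑ x, q x * b x = 0) (n : ℕ) :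
    ∑ x : Fin n → m, (∏ k, q (x k)) * ∑ k, b (x k) = 0 := by
  induction n with
  | zero => simp
  | succ n ih =>
    have h1 : ∑ x : Fin n → m, ∏ k, q (x k) = 1 := by rw [← Fintype.sum_pow, hq, one_pow]
    rw [sum_fin_succ_pi]
    calc _ = ∑ a, (q a * b a * (∑ x : Fin n → m, ∏ k, q (x k)) +
          q a * ∑ x : Fin n → m, (∏ k, q (x k)) * ∑ k, b (x k)) := by
          refine Finset.sum_congr rfl fun a _ => ?_
          rw [Finset.mul_sum, Finset.mul_sum, ← Finset.sum_add_distrib]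
          refine Finset.sum_congr rfl fun x _ => ?_
          simp only [Fin.prod_univ_succ, Fin.sum_univ_succ, Fin.cons_zero, Fin.cons_succ]
          ring
      _ = 0 := by simp [ih, h1, hb]

/-- The variance of a sum of `n` independent centred variables is `n` times the variance. -/
theorem sum_prod_mul_sum_sq {m : Type*} [Fintype m] {q b : m → ℝ} (hq : ∑ x, q x = 1)
    (hb : ∑ x, q x * b x = 0) (n : ℕ) :
    ∑ x : Fin n → m, (∏ k, q (x k)) * (∑ k, b (x k)) ^ 2 = n * ∑ x, q x * b x ^ 2 := by
  induction n with
  | zero => simp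
  | succ n ih =>
    have h1 : ∑ x : Fin n → m, ∏ k, q (x k) = 1 := by rw [← Fintype.sum_pow, hq, one_pow]
    rw [sum_fin_succ_pi]
    calc _ = ∑ a, (q a * b a ^ 2 * (∑ x : Fin n → m, ∏ k, q (x k)) +
          q a * b a * 2 * (∑ x : Fin n → m, (∏ k, q (x k)) * ∑ k, b (x k)) +
          q a * ∑ x : Fin n → m, (∏ k, q (x k)) * (∑ k, b (x k)) ^ 2) := by
          refine Finset.sum_congr rfl fun a _ => ?_
          rw [Finset.mul_sum, Finset.mul_sum, Finset.mul_sum, ← Finset.sum_add_distrib,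
            ← Finset.sum_add_distrib]
          refine Finset.sum_congr rfl fun x _ => ?_
          simp only [Fin.prod_univ_succ, Fin.sum_univ_succ, Fin.cons_zero, Fin.cons_succ]
          ring
      _ = _ := by
          rw [ih, h1, sum_prod_mul_sum_eq_zero hq hb, Finset.sum_add_distrib, ← Finset.sum_mul,
            hq]
          push_cast
          simp only [mul_one, mul_zero, add_zero]
          ring

/-- Centred sums of `n` independent variables are of size `√n`, so by Jensen's inequality the
expectation of `exp (-∑ i, |⬝|)` of finitely many of them decays only like `exp (-C √n)`. -/
theorem exists_exp_neg_sqrt_le {ι m : Type*} [Fintype ι] [Fintype m] {q : m → ℝ}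
    {c : ι → m → ℝ} (hq0 : ∀ x, 0 ≤ q x) (hq : ∑ x, q x = 1)
    (hc : ∀ i, ∑ x, q x * c i x = 0) :
    ∃ C : ℝ, ∀ n : ℕ, Real.exp (-(C * √n)) ≤
      ∑ x : Fin n → m, (∏ k, q (x k)) * Real.exp (-∑ i, |∑ k, c i (x k)|) := by
  refine ⟨∑ i, √(∑ x, q x * c i x ^ 2), fun n => ?_⟩
  have h1 : ∑ x : Fin n → m, ∏ k, q (x k) = 1 := by rw [← Fintype.sum_pow, hq, one_pow]
  have h0 : ∀ x : Fin n → m, 0 ≤ ∏ k, q (x k) := fun x => Finset.prod_nonneg fun k _ => hq0 _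
  have hJ := convexOn_exp.map_sum_le (t := Finset.univ) (w := fun x : Fin n → m => ∏ k, q (x k))
    (p := fun x => -∑ i, |∑ k, c i (x k)|) (fun x _ => h0 x) h1 (fun _ _ => Set.mem_univ _)
  simp only [smul_eq_mul] at hJ
  refine le_trans (Real.exp_le_exp.mpr ?_) hJ
  simp only [mul_neg, Finset.sum_neg_distrib, neg_le_neg_iff, Finset.mul_sum, Finset.sum_mul]
  rw [Finset.sum_comm]
  refine Finset.sum_le_sum fun i _ => ?_
  rw [← Real.sqrt_mul (Finset.sum_nonneg fun x _ => mul_nonneg (hq0 x) (sq_nonneg _))]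
  apply Real.le_sqrt_of_sq_le
  refine (Real.pow_arith_mean_le_arith_mean_pow Finset.univ _ _ (fun x _ => h0 x) h1
    (fun x _ => abs_nonneg _) 2).trans_eq ?_
  simp only [sq_abs]
  rw [sum_prod_mul_sum_sq hq (hc i), mul_comm]

/-! ### Minimising the Hellinger transform -/

/-- First order optimality conditions: at a minimiser `s` of `∑ x ∈ S, exp (∑ i, s i * a i x)` on
the (compact) simplex, the derivative in the direction of every vertex is nonnegative. -/
theorem exists_mem_stdSimplex_deriv_nonneg {ι m : Type*} [Fintype ι] [Nonempty ι] (S : Finset m)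
    (a : ι → m → ℝ) :
    ∃ s ∈ stdSimplex ℝ ι,
      ∀ i, 0 ≤ ∑ x ∈ S, Real.exp (∑ j, s j * a j x) * (a i x - ∑ j, s j * a j x) := by
  classical
  obtain ⟨s, hs, hmin⟩ := (isCompact_stdSimplex ι (𝕜 := ℝ)).exists_isMinOn
    ⟨_, single_mem_stdSimplex ℝ (Classical.arbitrary ι)⟩
    (f := fun s => ∑ x ∈ S, Real.exp (∑ j, s j * a j x)) (by fun_prop)
  refine ⟨s, hs, fun i => ?_⟩
  -- the sum along the segment from `s` to the vertex `i`
  let g : ℝ → ℝ := fun t =>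
    ∑ x ∈ S, Real.exp (∑ j, s j * a j x + t * (a i x - ∑ j, s j * a j x))
  have hg : HasDerivAt g
      (∑ x ∈ S, Real.exp (∑ j, s j * a j x) * (a i x - ∑ j, s j * a j x)) 0 := by
    refine HasDerivAt.fun_sum fun x _ => ?_
    have h := (((hasDerivAt_id (0 : ℝ)).mul_const (a i x - ∑ j, s j * a j x)).const_add
      (∑ j, s j * a j x)).exp
    simpa using h
  refine ge_of_tendsto hg.tendsto_slope_zero_right ?_
  filter_upwards [Ioo_mem_nhdsGT (zero_lt_one' ℝ)] with t ht
  refine mul_nonneg (inv_nonneg.mpr ht.1.le) (sub_nonneg.mpr ?_)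
  have hmem : (1 - t) • s + t • Pi.single i 1 ∈ stdSimplex ℝ ι :=
    convex_stdSimplex ℝ ι hs (single_mem_stdSimplex ℝ i) (by linarith [ht.2]) ht.1.le (by ring)
  have h := hmin hmem
  simp only [Set.mem_ofPred_eq] at h
  have e0 : g 0 = ∑ x ∈ S, Real.exp (∑ j, s j * a j x) := by simp [g]
  have e1 : g (0 + t) =
      ∑ x ∈ S, Real.exp (∑ j, ((1 - t) • s + t • Pi.single i 1 : ι → ℝ) j * a j x) := by
    refine Finset.sum_congr rfl fun x _ => congrArg Real.exp ?_
    simp only [Pi.add_apply, Pi.smul_apply, smul_eq_mul, add_mul, Finset.sum_add_distrib,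
      mul_assoc, ← Finset.mul_sum]
    simp [Pi.single_apply]
    ring
  rw [e0, e1]
  exact h

/-! ### Exponential rates -/

/-- The exponential rate `liminf_n -(1/n) ln (f n)` of a sequence of nonnegative real numbers, an
extended real number with `-ln 0 = +∞`. By definition, `optimalErrorExponent` is the rate of the
optimal error probabilities. -/
noncomputable def decayRate (f : ℕ → ℝ) : EReal :=
  Filter.liminf (fun n : ℕ => -ENNReal.log (ENNReal.ofReal (f n)) / (n : EReal)) Filter.atTop

theorem decayRate_anti {f g : ℕ → ℝ} (h : ∀ n, f n ≤ g n) : decayRate g ≤ decayRate f := by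
  refine Filter.liminf_le_liminf (Filter.Eventually.of_forall fun n => ?_)
  exact EReal.div_le_div_right_of_nonneg (by positivity)
    (EReal.neg_le_neg_iff.mpr (ENNReal.log_monotone (ENNReal.ofReal_le_ofReal (h n))))

/-- Subexponential factors do not change the exponential rate. -/
theorem decayRate_le_of_mul_le {f g C : ℕ → ℝ} (hC : ∀ n, 0 < C n)
    (hlim : Filter.Tendsto (fun n : ℕ => Real.log (C n) / n) Filter.atTop (nhds 0))
    (h : ∀ n, C n * f n ≤ g n) : decayRate g ≤ decayRate f := by
  refine (decayRate_anti h).trans ?_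
  have hu : Filter.limsup (fun n : ℕ => ((-(Real.log (C n) / n) : ℝ) : EReal)) Filter.atTop
      = 0 := by
    have h1 := (continuous_coe_real_ereal.tendsto _).comp hlim.neg
    rw [neg_zero] at h1
    exact h1.limsup_eq
  have key : ∀ n : ℕ, -ENNReal.log (ENNReal.ofReal (C n * f n)) / (n : EReal) =
      ((-(Real.log (C n) / n) : ℝ) : EReal) +
        -ENNReal.log (ENNReal.ofReal (f n)) / (n : EReal) := by
    intro n
    rw [ENNReal.ofReal_mul (hC n).le, ENNReal.log_mul_add, ENNReal.log_ofReal_of_pos (hC n),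
      EReal.neg_add (by simp) (by simp), sub_eq_add_neg,
      EReal.add_div_of_nonneg_right (by positivity), ← neg_div, EReal.coe_div, EReal.coe_neg]
    rfl
  unfold decayRate
  simp only [key]
  refine (EReal.liminf_add_le (Or.inl (by rw [hu]; simp)) (Or.inl (by rw [hu]; simp))).trans ?_
  rw [hu, zero_add]

theorem decayRate_pow (z : ℝ) (hz : 0 ≤ z) :
    decayRate (fun n => z ^ n) = -ENNReal.log (ENNReal.ofReal z) := by
  refine Filter.Tendsto.liminf_eq (tendsto_const_nhds.congr' ?_)
  filter_upwards [Filter.eventually_gt_atTop 0] with n hn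
  rw [ENNReal.ofReal_pow hz, ENNReal.log_pow, ← mul_neg, ← EReal.mul_div,
    EReal.mul_div_cancel (EReal.natCast_ne_bot n) (EReal.natCast_ne_top n)
      (by exact_mod_cast hn.ne')]

/-! ### The Hellinger transform on a finite alphabet -/

theorem ENNReal.prod_rpow_eq_self_of_sum_eq_one {ι : Type*} [Fintype ι] {x : ℝ≥0∞} {s : ι → ℝ}
    (hs0 : ∀ i, 0 ≤ s i) (hs : ∑ i, s i = 1) : ∏ i, x ^ s i = x := by
  have h : ∀ T : Finset ι, ∏ i ∈ T, x ^ s i = x ^ ∑ i ∈ T, s i := by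
    classical
    intro T
    induction T using Finset.induction_on with
    | empty => simp
    | insert a T ha ih =>
      rw [Finset.prod_insert ha, Finset.sum_insert ha, ih,
        ENNReal.rpow_add_of_nonneg _ _ (hs0 a) (Finset.sum_nonneg fun i _ => hs0 i)]
  rw [h, hs, ENNReal.rpow_one]

theorem weightMeasure_singleton {m : ℕ} (v : Fin m → ℝ) (x : Fin m) :
    weightMeasure v {x} = ENNReal.ofReal (v x) := by
  rw [weightMeasure, MeasureTheory.Measure.finsetSum_apply, Finset.sum_eq_single x]
  · simp
  · intro y _ hy
    simp [hy]
  · simp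

instance isFiniteMeasure_weightMeasure {m : ℕ} (v : Fin m → ℝ) :
    MeasureTheory.IsFiniteMeasure (weightMeasure v) := by
  refine ⟨?_⟩
  rw [← Set.biUnion_of_singleton Set.univ]
  refine (MeasureTheory.measure_biUnion_lt_top Set.finite_univ fun x _ => ?_)
  rw [weightMeasure_singleton]
  exact ENNReal.ofReal_lt_top

/-- On a finite alphabet the Hellinger transform is `∑ x, ∏ i, (p i x) ^ (s i)`. The weights of
the dominating measure cancel because the exponents sum to one. -/
theorem hellingerTransform_weightMeasure {r m : ℕ} {w : Fin r → ℝ} (hw : IsPrior w)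
    {p : Fin r → Fin m → ℝ} (hp : ∀ i x, 0 ≤ p i x) {s : Fin r → ℝ}
    (hs : s ∈ stdSimplex ℝ (Fin r)) :
    hellingerTransform w (fun l => weightMeasure (p l)) s =
      ENNReal.ofReal (∑ x, ∏ i, p i x ^ s i) := by
  set μ := dominatingMeasure w (fun l => weightMeasure (p l)) with hμ
  have hμfin : MeasureTheory.IsFiniteMeasure μ := by
    refine ⟨?_⟩
    rw [hμ, dominatingMeasure, MeasureTheory.Measure.finsetSum_apply]
    exact ENNReal.sum_lt_top.mpr fun i _ => ENNReal.mul_lt_top ENNReal.ofReal_lt_top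
      (MeasureTheory.measure_lt_top _ _)
  have hac : ∀ l, (weightMeasure (p l)).AbsolutelyContinuous μ := by
    intro l t ht
    rw [hμ, dominatingMeasure, MeasureTheory.Measure.finsetSum_apply,
      Finset.sum_eq_zero_iff] at ht
    have := ht l (Finset.mem_univ l)
    simpa [(hw.1 l).not_ge] using this
  have hrn : ∀ l x, (weightMeasure (p l)).rnDeriv μ x * μ {x} = ENNReal.ofReal (p l x) := by
    intro l x
    rw [← weightMeasure_singleton, ← MeasureTheory.Measure.setLIntegral_rnDeriv (hac l) {x},
      MeasureTheory.lintegral_singleton]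
  rw [hellingerTransform, ← hμ, MeasureTheory.lintegral_fintype,
    ENNReal.ofReal_sum_of_nonneg fun x _ =>
      Finset.prod_nonneg fun i _ => Real.rpow_nonneg (hp i x) _]
  refine Finset.sum_congr rfl fun x _ => ?_
  conv_lhs => rw [← ENNReal.prod_rpow_eq_self_of_sum_eq_one (x := μ {x}) hs.1 hs.2]
  rw [← Finset.prod_mul_distrib,
    ENNReal.ofReal_prod_of_nonneg fun i _ => Real.rpow_nonneg (hp i x) _]
  refine Finset.prod_congr rfl fun i _ => ?_
  rw [← ENNReal.mul_rpow_of_nonneg _ _ (hs.1 i), hrn,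
    ENNReal.ofReal_rpow_of_nonneg (hp i x) (hs.1 i)]

/-- The Hellinger transform may jump up at the boundary of the simplex (because `0 ^ 0 = 1`), but
its infimum does not see this: it is at most the value of the sum over the common support, which
agrees with the transform in the interior and is continuous. -/
theorem iInf_hellinger_le {r m : ℕ} (hr : 0 < r) {p : Fin r → Fin m → ℝ}
    (hp : ∀ i x, 0 ≤ p i x) {S : Finset (Fin m)} (hS : ∀ x, x ∈ S ↔ ∀ i, 0 < p i x)
    {s : Fin r → ℝ} (hs : s ∈ stdSimplex ℝ (Fin r)) :
    ⨅ t ∈ stdSimplex ℝ (Fin r), ENNReal.ofReal (∑ x, ∏ i, p i x ^ t i) ≤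
      ENNReal.ofReal (∑ x ∈ S, Real.exp (∑ i, s i * Real.log (p i x))) := by
  have hr' : (0 : ℝ) < r := by exact_mod_cast hr
  -- interior points converging to `s`
  let c : ℝ → Fin r → ℝ := fun t i => (1 - t) * s i + t * (r : ℝ)⁻¹
  have hlim : Filter.Tendsto
      (fun t => ENNReal.ofReal (∑ x ∈ S, Real.exp (∑ i, c t i * Real.log (p i x))))
      (nhdsWithin 0 (Set.Ioi 0))
      (nhds (ENNReal.ofReal (∑ x ∈ S, Real.exp (∑ i, s i * Real.log (p i x))))) := by
    have hcont : Continuous fun t : ℝ =>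
        ENNReal.ofReal (∑ x ∈ S, Real.exp (∑ i, c t i * Real.log (p i x))) :=
      ENNReal.continuous_ofReal.comp (by fun_prop)
    have h := (hcont.tendsto 0).mono_left (nhdsWithin_le_nhds (s := Set.Ioi (0 : ℝ)))
    simpa [c] using h
  refine ge_of_tendsto hlim ?_
  filter_upwards [Ioo_mem_nhdsGT (zero_lt_one' ℝ)] with t ht
  have hpos : ∀ i, 0 < c t i := fun i =>
    add_pos_of_nonneg_of_pos (mul_nonneg (by linarith [ht.2]) (hs.1 i))
      (mul_pos ht.1 (inv_pos.mpr hr'))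
  have hmem : c t ∈ stdSimplex ℝ (Fin r) := by
    refine ⟨fun i => (hpos i).le, ?_⟩
    simp only [c, Finset.sum_add_distrib, ← Finset.mul_sum, hs.2]
    simp [hr'.ne']
  refine (iInf₂_le (c t) hmem).trans_eq (congrArg _ ?_)
  rw [← Finset.sum_subset (Finset.subset_univ S)]
  · refine Finset.sum_congr rfl fun x hx => ?_
    rw [Real.exp_sum]
    refine Finset.prod_congr rfl fun i _ => ?_
    rw [Real.rpow_def_of_pos ((hS x).mp hx i), mul_comm]
  · intro x _ hx
    rw [hS] at hx
    push Not at hx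
    obtain ⟨i, hi⟩ := hx
    refine Finset.prod_eq_zero (Finset.mem_univ i) ?_
    rw [le_antisymm hi (hp i x), Real.zero_rpow (hpos i).ne']

/-! ### The classical error exponent -/

/-- The change of measure behind the converse bound. Tilting by the minimiser `s` of the sum over
the common support `S` makes every log-likelihood `log (p i)` at least as large in expectation as
the mixture `∑ j, s j * log (p j)`, so that the tilted weights, damped by the fluctuations, are a
common lower bound of all product weights. -/
theorem exists_common_lower_bound {r : ℕ} {m : Type*} [Fintype m] (hr : 0 < r)
    {p : Fin r → m → ℝ} (hp : ∀ i x, 0 ≤ p i x) {S : Finset m} (hne : S.Nonempty)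
    (hS : ∀ x ∈ S, ∀ i, 0 < p i x) :
    ∃ s ∈ stdSimplex ℝ (Fin r), ∃ C : ℝ, ∀ n : ℕ, ∃ Q : (Fin n → m) → ℝ,
      (∀ i x, Q x ≤ ∏ k, p i (x k)) ∧
      Real.exp (-(C * √n)) * (∑ x ∈ S, Real.exp (∑ i, s i * Real.log (p i x))) ^ n ≤
        ∑ x, Q x := by
  classical
  have : Nonempty (Fin r) := ⟨⟨0, hr⟩⟩
  obtain ⟨s, hs, hder⟩ := exists_mem_stdSimplex_deriv_nonneg S (fun i x => Real.log (p i x))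
  set g : m → ℝ := fun x => ∑ j, s j * Real.log (p j x)
  set Z : ℝ := ∑ x ∈ S, Real.exp (g x) with hZ
  have hZpos : 0 < Z := Finset.sum_pos (fun x _ => Real.exp_pos _) hne
  -- the tilted distribution, and the centred log-likelihood ratios `c i` under it
  let q : m → ℝ := fun x => if x ∈ S then Real.exp (g x) / Z else 0
  have hq0 : ∀ x, 0 ≤ q x := by
    intro x
    simp only [q]
    split_ifs <;> positivity
  have hqf : ∀ f : m → ℝ, ∑ x, q x * f x = (∑ x ∈ S, Real.exp (g x) * f x) / Z := by
    intro f
    simp only [q, ite_mul, zero_mul, Finset.sum_ite_mem, Finset.univ_inter, Finset.sum_div]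
    exact Finset.sum_congr rfl fun x _ => by ring
  have hq1 : ∑ x, q x = 1 := by
    have h := hqf fun _ => 1
    simp only [mul_one] at h
    rw [h, ← hZ, div_self hZpos.ne']
  let E : Fin r → ℝ := fun i => ∑ x, q x * (Real.log (p i x) - g x)
  have hE : ∀ i, 0 ≤ E i := fun i => by
    simp only [E, hqf]
    exact div_nonneg (hder i) hZpos.le
  let c : Fin r → m → ℝ := fun i x => Real.log (p i x) - g x - E i
  have hc : ∀ i, ∑ x, q x * c i x = 0 := by
    intro i
    simp only [c, mul_sub _ _ (E i), Finset.sum_sub_distrib, ← Finset.sum_mul, hq1, one_mul]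
    exact sub_self _
  obtain ⟨C, hC⟩ := exists_exp_neg_sqrt_le hq0 hq1 hc
  refine ⟨s, hs, C, fun n => ⟨fun x => Z ^ n * ((∏ k, q (x k)) *
    Real.exp (-∑ i, |∑ k, c i (x k)|)), fun i x => ?_, ?_⟩⟩
  · by_cases hx : ∀ k, x k ∈ S
    · have h1 : Z ^ n * ∏ k, q (x k) = Real.exp (∑ k, g (x k)) := by
        simp only [q, hx, if_true, Finset.prod_div_distrib, Finset.prod_const, Finset.card_univ,
          Fintype.card_fin, ← Real.exp_sum]
        field_simp
      have h2 : ∏ k, p i (x k) = Real.exp (∑ k, Real.log (p i (x k))) := by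
        rw [Real.exp_sum]
        exact Finset.prod_congr rfl fun k _ => (Real.exp_log (hS _ (hx k) i)).symm
      beta_reduce
      rw [← mul_assoc, h1, h2, ← Real.exp_add, Real.exp_le_exp]
      have h3 : ∑ k, c i (x k) = ∑ k, Real.log (p i (x k)) - ∑ k, g (x k) - n * E i := by
        simp [c, Finset.sum_sub_distrib]
      have h4 : |∑ k, c i (x k)| ≤ ∑ i, |∑ k, c i (x k)| :=
        Finset.single_le_sum (f := fun i => |∑ k, c i (x k)|) (fun _ _ => abs_nonneg _)
          (Finset.mem_univ i)
      have h5 := neg_abs_le (∑ k, c i (x k))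
      have h6 : 0 ≤ n * E i := mul_nonneg (Nat.cast_nonneg n) (hE i)
      linarith
    · push Not at hx
      obtain ⟨k, hk⟩ := hx
      have h1 : ∏ k, q (x k) = 0 := Finset.prod_eq_zero (Finset.mem_univ k) (by simp [q, hk])
      simp only [h1, zero_mul, mul_zero]
      exact Finset.prod_nonneg fun k _ => hp i _
  · rw [← Finset.mul_sum, mul_comm]
    exact mul_le_mul_of_nonneg_left (hC n) (pow_nonneg hZpos.le n)

theorem tendsto_log_mul_exp_neg_sqrt_div {c : ℝ} (hc : 0 < c) (C : ℝ) :
    Filter.Tendsto (fun n : ℕ => Real.log (c * Real.exp (-(C * √n))) / n) Filter.atTop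
      (nhds 0) := by
  have h1 : Filter.Tendsto (fun n : ℕ => Real.log c / n) Filter.atTop (nhds 0) :=
    tendsto_const_div_atTop_nhds_zero_nat _
  have h2 : Filter.Tendsto (fun n : ℕ => C / √(n : ℝ)) Filter.atTop (nhds 0) :=
    Filter.Tendsto.const_div_atTop (Real.tendsto_sqrt_atTop.comp tendsto_natCast_atTop_atTop) C
  have h3 := h1.sub h2
  rw [sub_zero] at h3
  refine h3.congr fun n => ?_
  rw [Real.log_mul hc.ne' (Real.exp_ne_zero _), Real.log_exp, ← sub_eq_add_neg, sub_div,
    mul_div_assoc, Real.sqrt_div_self', mul_one_div]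

/-! ### Properties of the optimal error exponent -/

theorem optimalErrorExponent_le_of_prior {r : ℕ} (hr : 0 < r) {η η' : Fin r → ℝ}
    (hη : IsPrior η) (hη' : IsPrior η') (d : Type u) [Fintype d] [DecidableEq d]
    (ρ : Fin r → DensityMatrix d) : optimalErrorExponent η d ρ ≤ optimalErrorExponent η' d ρ := by
  have : Nonempty (Fin r) := ⟨⟨0, hr⟩⟩
  obtain ⟨i₀, hi₀⟩ := Finite.exists_min η
  refine decayRate_le_of_mul_le (C := fun _ => η i₀) (fun _ => hη.1 i₀)
    (tendsto_const_div_atTop_nhds_zero_nat _) fun n => ?_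
  refine le_optimalErrorProbability hr fun M => ?_
  refine (mul_le_mul_of_nonneg_left
    (optimalErrorProbability_le (fun i => (hη'.1 i).le) M _) (hη.1 i₀).le).trans ?_
  rw [errorProbability, errorProbability, Finset.mul_sum]
  refine Finset.sum_le_sum fun i _ => ?_
  -- the error of outcome `i` alone is the error probability for the weights `Pi.single i 1`
  have htr : 0 ≤ ((M.op i * ((ρ i).tensorPower n).mat).trace).re := by
    have h := errorProbability_nonneg (η := Pi.single i 1)
      (fun j => by by_cases hj : j = i <;> simp [hj]) M
      (fun i => (ρ i).tensorPower n)
    simpa [errorProbability, Pi.single_apply] using h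
  rw [← mul_assoc]
  refine mul_le_mul_of_nonneg_right ?_ htr
  calc η i₀ * η' i ≤ η i₀ * 1 := mul_le_mul_of_nonneg_left (hη'.le_one i) (hη.1 i₀).le
    _ ≤ η i := by simpa using hi₀ i

theorem optimalErrorExponent_nonneg {r : ℕ} (hr : 0 < r) {η : Fin r → ℝ} (hη : IsPrior η)
    (d : Type u) [Fintype d] [DecidableEq d] (ρ : Fin r → DensityMatrix d) :
    0 ≤ optimalErrorExponent η d ρ := by
  have h := decayRate_anti
    (f := fun n => optimalErrorProbability η fun i => (ρ i).tensorPower n) (g := fun n => 1 ^ n)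
    fun n => by simpa using optimalErrorProbability_le_one hr hη _
  rw [decayRate_pow 1 zero_le_one, ENNReal.ofReal_one, ENNReal.log_one, neg_zero] at h
  exact h

/-- Deciding for a least likely hypothesis, together with `min ≤` weighted geometric mean, bounds
the error by the `n`-th power of the Hellinger transform. -/
theorem optimalErrorProbability_tensorPower_le_pow {r : ℕ} (hr : 0 < r) {η : Fin r → ℝ}
    (hη : IsPrior η) {d : Type u} [Fintype d] [DecidableEq d] {ρ : Fin r → DensityMatrix d}
    {b : OrthonormalBasis (Fin (Fintype.card d)) ℂ (EuclideanSpace ℂ d)}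
    {lam : Fin r → Fin (Fintype.card d) → ℝ} (h : IsCommonSpectralDecomposition ρ b lam)
    {s : Fin r → ℝ} (hs : s ∈ stdSimplex ℝ (Fin r)) (n : ℕ) :
    optimalErrorProbability η (fun i => (ρ i).tensorPower n) ≤
      (∑ x, ∏ i, lam i x ^ s i) ^ n := by
  have : Nonempty (Fin r) := ⟨⟨0, hr⟩⟩
  have hpn : ∀ i (x : Fin n → Fin (Fintype.card d)), 0 ≤ ∏ k, lam i (x k) :=
    fun i x => Finset.prod_nonneg fun k _ => h.nonneg i _
  choose f hf using fun x : Fin n → Fin (Fintype.card d) =>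
    Finite.exists_min fun i => ∏ k, lam i (x k)
  refine (optimalErrorProbability_le_sum_of_diagonal
    (V := rectTensorPower n (basisMatrix b))
    (by rw [← rectTensorPower_conjTranspose, ← rectTensorPower_mul,
      basisMatrix_conjTranspose_mul, rectTensorPower_one])
    (by rw [← rectTensorPower_conjTranspose, ← rectTensorPower_mul,
      basisMatrix_mul_conjTranspose, rectTensorPower_one])
    (fun i => (hη.1 i).le) (h.tensorPower_mat_eq n) f).trans ?_
  rw [Fintype.sum_pow]
  refine Finset.sum_le_sum fun x _ => ?_
  set y := ∏ k, lam (f x) (x k) with hy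
  have hy0 : 0 ≤ y := hpn _ _
  calc η (f x) * y ≤ 1 * y := mul_le_mul_of_nonneg_right (hη.le_one _) hy0
    _ = ∏ i, y ^ s i := by
      rw [one_mul, ← Real.rpow_sum_of_nonneg hy0 fun i _ => hs.1 i, hs.2, Real.rpow_one]
    _ ≤ ∏ i, (∏ k, lam i (x k)) ^ s i :=
      Finset.prod_le_prod (fun i _ => Real.rpow_nonneg hy0 _) fun i _ =>
        Real.rpow_le_rpow hy0 (hf x i) (hs.1 i)
    _ = ∏ k, ∏ i, lam i (x k) ^ s i := by
      rw [Finset.prod_comm]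
      refine Finset.prod_congr rfl fun i _ => ?_
      rw [Real.finsetProd_rpow _ _ fun k _ => h.nonneg i _]

theorem optimalErrorExponent_eq_classicalChernoffDivergence {r : ℕ} (hr : 0 < r)
    {η : Fin r → ℝ} (hη : IsPrior η) (d : Type u) [Fintype d] [DecidableEq d]
    (ρ : Fin r → DensityMatrix d)
    (b : OrthonormalBasis (Fin (Fintype.card d)) ℂ (EuclideanSpace ℂ d))
    (lam : Fin r → Fin (Fintype.card d) → ℝ) (h : IsCommonSpectralDecomposition ρ b lam)
    (w : Fin r → ℝ) (hw : IsPrior w) :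
    optimalErrorExponent η d ρ =
      classicalChernoffDivergence w (fun l => weightMeasure (lam l)) := by
  classical
  have : Nonempty (Fin r) := ⟨⟨0, hr⟩⟩
  have hH : ⨅ s ∈ stdSimplex ℝ (Fin r),
      hellingerTransform w (fun l => weightMeasure (lam l)) s =
      ⨅ s ∈ stdSimplex ℝ (Fin r), ENNReal.ofReal (∑ x, ∏ i, lam i x ^ s i) :=
    iInf_congr fun s => iInf_congr fun hs => hellingerTransform_weightMeasure hw h.nonneg hs
  rw [classicalChernoffDivergence, hH]
  refine le_antisymm ?_ ?_
  · set S : Finset (Fin (Fintype.card d)) := {x | ∀ i, 0 < lam i x} with hSdef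
    have hS : ∀ x, x ∈ S ↔ ∀ i, 0 < lam i x := fun x => by simp [hSdef]
    rcases S.eq_empty_or_nonempty with hemp | hne
    · -- without common support the infimum is zero and the divergence is `⊤`
      have h0 := iInf_hellinger_le hr h.nonneg hS
        (single_mem_stdSimplex ℝ (Classical.arbitrary (Fin r)))
      rw [hemp, Finset.sum_empty, ENNReal.ofReal_zero, nonpos_iff_eq_zero] at h0
      rw [h0, ENNReal.log_zero, EReal.neg_bot]
      exact le_top
    · obtain ⟨s, hs, C, hC⟩ := exists_common_lower_bound hr h.nonneg hne
        fun x hx => (hS x).mp hx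
      obtain ⟨i₀, hi₀⟩ := Finite.exists_min η
      have hZ : 0 ≤ ∑ x ∈ S, Real.exp (∑ i, s i * Real.log (lam i x)) :=
        Finset.sum_nonneg fun x _ => (Real.exp_pos _).le
      refine (decayRate_le_of_mul_le
        (f := fun n => (∑ x ∈ S, Real.exp (∑ i, s i * Real.log (lam i x))) ^ n)
        (C := fun n => η i₀ * Real.exp (-(C * √n)))
        (fun n => mul_pos (hη.1 i₀) (Real.exp_pos _))
        (tendsto_log_mul_exp_neg_sqrt_div (hη.1 i₀) C) fun n => ?_).trans ?_
      · obtain ⟨Q, hQ, hQs⟩ := hC n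
        refine le_optimalErrorProbability hr fun M => le_trans ?_
          (sum_le_errorProbability_of_diagonal (V := rectTensorPower n (basisMatrix b))
            (by rw [← rectTensorPower_conjTranspose, ← rectTensorPower_mul,
              basisMatrix_conjTranspose_mul, rectTensorPower_one])
            (h.tensorPower_mat_eq n) (q := fun x => η i₀ * Q x) (fun i x => ?_) M)
        · rw [← Finset.mul_sum, mul_assoc]
          exact mul_le_mul_of_nonneg_left hQs (hη.1 i₀).le
        · exact (mul_le_mul_of_nonneg_left (hQ i x) (hη.1 i₀).le).trans
            (mul_le_mul_of_nonneg_right (hi₀ i)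
              (Finset.prod_nonneg fun k _ => h.nonneg i _))
      · rw [decayRate_pow _ hZ, EReal.neg_le_neg_iff]
        exact ENNReal.log_monotone (iInf_hellinger_le hr h.nonneg hS hs)
  · rw [EReal.neg_le, ← EReal.log_exp (-optimalErrorExponent η d ρ)]
    refine ENNReal.log_monotone (le_iInf₂ fun s hs => ?_)
    rw [← ENNReal.log_le_log_iff, EReal.log_exp, EReal.neg_le]
    have h1 := decayRate_anti (optimalErrorProbability_tensorPower_le_pow hr hη h hs)
    rwa [decayRate_pow _ (Finset.sum_nonneg fun x _ => Finset.prod_nonneg fun i _ =>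
      Real.rpow_nonneg (h.nonneg i x) _)] at h1

theorem mainTheorem5 (r : ℕ) (hr : 2 ≤ r) :
    (∀ (η η' : Fin r → ℝ), IsPrior η → IsPrior η' →
      ∀ (d : Type u) [Fintype d] [DecidableEq d] (ρ : Fin r → DensityMatrix d),
        optimalErrorExponent η d ρ = optimalErrorExponent η' d ρ) ∧
    ∀ η : Fin r → ℝ, IsPrior η →
      IsMultivariateQuantumChernoffDivergence.{u} (optimalErrorExponent η) := by
  have hr0 : 0 < r := by omega
  refine ⟨fun η η' hη hη' d _ _ ρ => le_antisymm
    (optimalErrorExponent_le_of_prior hr0 hη hη' d ρ)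
    (optimalErrorExponent_le_of_prior hr0 hη' hη d ρ), fun η hη => ?_⟩
  exact
    { nonneg := fun d _ _ ρ => optimalErrorExponent_nonneg hr0 hη d ρ
      data_processing := fun d e _ _ _ _ ρ N => decayRate_anti
        (optimalErrorProbability_tensorPower_le_apply hr0 (fun i => (hη.1 i).le) ρ N)
      eq_classical_of_commute := fun d _ _ ρ _ b lam h w hw =>
        optimalErrorExponent_eq_classicalChernoffDivergence hr0 hη d ρ b lam h w hw }
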